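/- Let $(X_i)_{i\ge 1}$ be a sequence of independent real random variables on a probability space, where $X_i$ is exponentially distributed with rate $i$ (that is, $P(X_i>t)=e^{-it}$ for all $t\ge 0$), and let $M=\sup_{i\ge 1}X_i$ (as an extended real-valued random variable). Then, as $m\to\infty$, $$P(X_m=M)=\pi\sqrt{2m}\cdot e^{-\pi\sqrt{2/3}\,\sqrt{m}}\cdot(1+o(1)).$$ -/

import Mathlib

open MeasureTheory ProbabilityTheory Filter Asymptotics

/-! Let φ be the Euler function and L(s) = ∫₀^∞ e^{-st} φ(e^{-t}) dt. Conditioning on X_m = t, the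
other variables stay below t with probability φ(e^{-t})/(1 - e^{-mt}). Expanding 1/(1 - e^{-mt})
geometrically gives P(X_m = M) = ∑_{k≥0} m L((k+1)m) (`hasSum_measureReal_eq_iSup`). The pentagonal
number theorem turns L(s) into an alternating series of 1/(s + pentagonal number). Completing the
square makes it a cosecant series at 1/6 + ic with 36c² = 24s - 1, so L has a closed form in
sinh(πc), cosh(πc) (`eulerLaplace_eq`). Since c ~ √(2s/3), s L(s) is asymptotic to the claimed
expression (`isEquivalent_mul_eulerLaplace`). The terms k ≥ 1 have exponents larger by a factor of
at least √2 and are negligible (`isLittleO_tsum_eulerLaplace`). -/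

/-- The Euler function `∏_{n ≥ 1} (1 - x ^ n)`. -/
noncomputable def eulerFunction (x : ℝ) : ℝ := ∏' n : ℕ, (1 - x ^ (n + 1))

/-! ### Pentagonal number theorem on [0, 1) -/

theorem multipliable_one_sub_pow_add {x : ℝ} (h0 : 0 ≤ x) (h1 : x < 1) (k : ℕ) :
    Multipliable fun n : ℕ => 1 - x ^ (n + k + 1) := by
  simp_rw [sub_eq_add_neg]
  apply multipliable_one_add_of_summable
  simp only [norm_neg, norm_pow, Real.norm_of_nonneg h0]
  have := (summable_geometric_of_lt_one h0 h1).mul_right (x ^ (k + 1))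
  refine this.congr fun n => by ring

theorem prod_one_sub_pow_mem_Icc {x : ℝ} (h0 : 0 ≤ x) (h1 : x < 1) (k n : ℕ) :
    ∏ i ∈ Finset.range n, (1 - x ^ (k + i + 1)) ∈ Set.Icc (0 : ℝ) 1 := by
  have h (i : ℕ) : x ^ i ≤ 1 := pow_le_one₀ h0 h1.le
  exact ⟨Finset.prod_nonneg fun i _ => sub_nonneg.2 (h _),
    Finset.prod_le_one (fun i _ => sub_nonneg.2 (h _)) fun i _ => by
      linarith [pow_nonneg h0 (k + i + 1)]⟩

theorem eulerFunction_mem_Icc {x : ℝ} (h0 : 0 ≤ x) (h1 : x < 1) :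
    eulerFunction x ∈ Set.Icc (0 : ℝ) 1 := by
  have h := (multipliable_one_sub_pow_add h0 h1 0).tendsto_prod_tprod_nat
  refine isClosed_Icc.mem_of_tendsto h (Eventually.of_forall fun n => ?_)
  simpa using prod_one_sub_pow_mem_Icc h0 h1 0 n

theorem natCast_le_pentagonal_neg (k : ℕ) : k ≤ pentagonal (-k) := by
  have := two_mul_natCast_pentagonal_neg k
  nlinarith

theorem pentagonal_neg_le_pentagonal_add_one (k : ℕ) : pentagonal (-k) ≤ pentagonal (k + 1) :=
  (pentagonal_neg_lt_pentagonal_add_one (by positivity)).le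

theorem norm_pentagonal_term_le {x : ℝ} (h0 : 0 ≤ x) (h1 : x < 1) (k : ℕ) :
    ‖(-1) ^ k * (x ^ pentagonal (-k) - x ^ pentagonal (k + 1))‖ ≤ x ^ k := by
  have h2 := pow_le_pow_of_le_one h0 h1.le (pentagonal_neg_le_pentagonal_add_one k)
  have h3 := pow_le_pow_of_le_one h0 h1.le (natCast_le_pentagonal_neg k)
  rw [norm_mul, norm_pow, norm_neg, norm_one, one_pow, one_mul, Real.norm_of_nonneg (by linarith)]
  linarith [pow_nonneg h0 (pentagonal (k + 1))]

/-- **Pentagonal number theorem** for real `x ∈ [0, 1)`. -/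
theorem hasSum_eulerFunction {x : ℝ} (h0 : 0 ≤ x) (h1 : x < 1) :
    HasSum (fun k : ℕ => (-1) ^ k * (x ^ pentagonal (-k) - x ^ pentagonal (k + 1)))
      (eulerFunction x) := by
  have hterm (k n : ℕ) :
      ‖x ^ ((k + 1) * n) * ∏ i ∈ Finset.range (n + 1), (1 - x ^ (k + i + 1))‖ ≤ x ^ n := by
    obtain ⟨h2, h3⟩ := prod_one_sub_pow_mem_Icc h0 h1 k (n + 1)
    rw [Real.norm_of_nonneg (by positivity)]
    calc _ ≤ x ^ ((k + 1) * n) := mul_le_of_le_one_right (by positivity) h3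
      _ ≤ x ^ n := pow_le_pow_of_le_one h0 h1.le (by nlinarith)
  have hgeo := summable_geometric_of_lt_one h0 h1
  have hrhs := Summable.of_norm_bounded hgeo (norm_pentagonal_term_le h0 h1)
  rw [eulerFunction, Pentagonal.tprod_one_sub_pow (tendsto_pow_atTop_nhds_zero_of_lt_one h0 h1)
    (fun k => Summable.of_norm_bounded hgeo (hterm k))
    (multipliable_one_sub_pow_add h0 h1) hrhs]
  · exact hrhs.hasSum
  -- The remainder of the pentagonal recursion is, up to sign, a power of x with exponent at least k
  -- times a sum bounded by (1 - x)⁻¹.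
  · have hlim : Tendsto (fun k : ℕ => x ^ k * (1 - x)⁻¹) atTop (nhds 0) := by
      simpa using (tendsto_pow_atTop_nhds_zero_of_lt_one h0 h1).mul_const ((1 - x)⁻¹)
    refine squeeze_zero_norm (fun k => ?_) hlim
    rw [norm_mul, norm_mul, norm_pow, norm_neg, norm_one, one_pow, one_mul, norm_pow,
      Real.norm_of_nonneg h0]
    have hk : k ≤ (k + 1) * (3 * k + 4) / 2 := by
      rw [Nat.le_div_iff_mul_le two_pos]; nlinarith
    exact mul_le_mul (pow_le_pow_of_le_one h0 h1.le hk)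
      (tsum_of_norm_bounded (hasSum_geometric_of_lt_one h0 h1) (hterm k)) (norm_nonneg _)
      (by positivity)

/-! ### Laplace transform as a series over pentagonal numbers -/

theorem integrableOn_exp_neg_mul {a : ℝ} (ha : 0 < a) :
    IntegrableOn (fun t : ℝ => Real.exp (-(a * t))) (Set.Ioi 0) := by
  simpa using integrableOn_exp_mul_Ioi (a := -a) (by linarith) 0

theorem integral_exp_neg_mul {a : ℝ} (ha : 0 < a) :
    ∫ t in Set.Ioi (0 : ℝ), Real.exp (-(a * t)) = 1 / a := by
  have := integral_exp_mul_Ioi (a := -a) (by linarith) 0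
  simpa [neg_div_neg_eq] using this

/-- The Mellin-type transform `∫₀^∞ e^{-st} ∏_{n ≥ 1} (1 - e^{-nt}) dt`. -/
noncomputable def eulerLaplace (s : ℝ) : ℝ :=
  ∫ t in Set.Ioi (0 : ℝ), Real.exp (-(s * t)) * eulerFunction (Real.exp (-t))

theorem summable_one_div_pentagonal_neg {s : ℝ} (hs : 0 < s) :
    Summable fun k : ℕ => 1 / (s + pentagonal (-k)) := by
  have h := (summable_nat_add_iff 1).2 (Real.summable_one_div_nat_pow (p := 2)|>.2 (by norm_num))
  -- The comparison starts at k = 1: at k = 0 the bound 1/k² would read 1/0 = 0.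
  refine (summable_nat_add_iff 1).1 (h.of_nonneg_of_le (fun k => by positivity) fun k => ?_)
  have h1 := two_mul_natCast_pentagonal_neg (k + 1)
  have h2 : ((k + 1 : ℕ) ^ 2 : ℝ) ≤ pentagonal (-((k + 1 : ℕ) : ℤ)) := by
    have : ((k + 1 : ℕ) ^ 2 : ℤ) ≤ pentagonal (-((k + 1 : ℕ) : ℤ)) := by
      push_cast
      nlinarith
    exact_mod_cast this
  exact one_div_le_one_div_of_le (by positivity) (by linarith)

theorem summable_one_div_pentagonal_add_one {s : ℝ} (hs : 0 < s) :
    Summable fun k : ℕ => 1 / (s + pentagonal (k + 1)) :=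
  (summable_one_div_pentagonal_neg hs).of_nonneg_of_le (fun k => by positivity) fun k =>
    one_div_le_one_div_of_le (by positivity) (by
      have := pentagonal_neg_le_pentagonal_add_one k
      have : (pentagonal (-k) : ℝ) ≤ pentagonal (k + 1) := by exact_mod_cast this
      linarith)

theorem hasSum_eulerLaplace {s : ℝ} (hs : 0 < s) :
    HasSum (fun k : ℕ => (-1 : ℝ) ^ k *
      (1 / (s + pentagonal (-k)) - 1 / (s + pentagonal (k + 1)))) (eulerLaplace s) := by
  let F (k : ℕ) (t : ℝ) : ℝ := (-1) ^ k *
    (Real.exp (-((s + pentagonal (-k)) * t)) - Real.exp (-((s + pentagonal (k + 1)) * t)))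
  -- The factor c is left free to serve both `F` (c = (-1)^k) and its norm (c = 1).
  have hint (k : ℕ) (c : ℝ) : Integrable (fun t : ℝ => c *
      (Real.exp (-((s + pentagonal (-k)) * t)) - Real.exp (-((s + pentagonal (k + 1)) * t))))
      (volume.restrict (Set.Ioi 0)) :=
    ((integrableOn_exp_neg_mul (by positivity)).sub
      (integrableOn_exp_neg_mul (by positivity))).const_mul _
  have hval (k : ℕ) (c : ℝ) : ∫ t in Set.Ioi (0 : ℝ), c *
      (Real.exp (-((s + pentagonal (-k)) * t)) - Real.exp (-((s + pentagonal (k + 1)) * t))) =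
      c * (1 / (s + pentagonal (-k)) - 1 / (s + pentagonal (k + 1))) := by
    rw [integral_const_mul, integral_sub (integrableOn_exp_neg_mul (by positivity))
      (integrableOn_exp_neg_mul (by positivity)), integral_exp_neg_mul (by positivity),
      integral_exp_neg_mul (by positivity)]
  have hnorm (k : ℕ) : ∫ t in Set.Ioi (0 : ℝ), ‖F k t‖ =
      1 / (s + pentagonal (-k)) - 1 / (s + pentagonal (k + 1)) := by
    rw [← one_mul (_ - _), ← hval k 1]
    refine setIntegral_congr_fun measurableSet_Ioi fun t ht => ?_
    have ht : (0 : ℝ) < t := ht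
    have := pentagonal_neg_le_pentagonal_add_one k
    have : (pentagonal (-k) : ℝ) ≤ pentagonal (k + 1) := by exact_mod_cast this
    have : Real.exp (-((s + pentagonal (k + 1)) * t)) ≤
      Real.exp (-((s + pentagonal (-k)) * t)) := Real.exp_le_exp.2 (by nlinarith)
    simp only [F, norm_mul, norm_pow, norm_neg, norm_one, one_pow]
    rw [Real.norm_of_nonneg (by linarith)]
  have hsum := hasSum_integral_of_summable_integral_norm (F := F)
    (μ := volume.restrict (Set.Ioi 0)) (fun k => hint k _) (by
      simp_rw [hnorm]
      exact (summable_one_div_pentagonal_neg hs).sub (summable_one_div_pentagonal_add_one hs))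
  simp only [F, hval] at hsum
  suffices h : eulerLaplace s = ∫ t in Set.Ioi (0 : ℝ), ∑' k, F k t by rwa [h]
  refine setIntegral_congr_fun measurableSet_Ioi fun t ht => ?_
  have ht : (0 : ℝ) < t := ht
  have h := (hasSum_eulerFunction (Real.exp_pos (-t)).le
    (by rw [Real.exp_lt_one_iff]; linarith)).mul_left (Real.exp (-(s * t)))
  rw [← h.tsum_eq]
  refine tsum_congr fun k => ?_
  rw [← Real.exp_nat_mul, ← Real.exp_nat_mul, mul_left_comm, mul_sub, ← Real.exp_add,
    ← Real.exp_add]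
  simp only [F]
  ring_nf

/-! ### Cosecant series and closed form -/

/-- The partial fraction expansion of the cosecant. -/
theorem hasSum_cosecant {z : ℂ} (hz : z ∈ Complex.integerComplement)
    (hz2 : z / 2 ∈ Complex.integerComplement) :
    HasSum (fun n : ℕ => (-1 : ℂ) ^ n * (1 / (z - n) + 1 / (z + n)))
      (Real.pi / Complex.sin (Real.pi * z) + 1 / z) := by
  -- The index n = 0 contributes 2/w, hence the extra 1/w beside π cot(πw).
  have hcot {w : ℂ} (hw : w ∈ Complex.integerComplement) :
      HasSum (fun n : ℕ => 1 / (w - n) + 1 / (w + n))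
        (Real.pi * Complex.cot (Real.pi * w) + 1 / w) := by
    have h := (summable_cotTerm hw).hasSum
    rw [← cot_series_rep' hw] at h
    rw [← hasSum_nat_add_iff' 1]
    simp only [Finset.range_one, Finset.sum_singleton, Nat.cast_zero, sub_zero, add_zero,
      Nat.cast_add, Nat.cast_one]
    rw [show Real.pi * Complex.cot (Real.pi * w) + 1 / w - (1 / w + 1 / w) =
      Real.pi * Complex.cot (Real.pi * w) - 1 / w by ring]
    exact h
  have hall := hcot hz
  -- The even terms are half the cotangent series at z/2. The alternating sum is even minus odd, and
  -- π/sin(πz) = π cot(πz/2) - π cot(πz).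
  have heven : HasSum (fun n : ℕ => 1 / (z - (2 * n : ℕ)) + 1 / (z + (2 * n : ℕ)))
      ((Real.pi * Complex.cot (Real.pi * (z / 2)) + 1 / (z / 2)) / 2) := by
    refine ((hcot hz2).div_const 2).congr_fun fun n => ?_
    have e1 : z - (2 * n : ℕ) = 2 * (z / 2 - n) := by push_cast; ring
    have e2 : z + (2 * n : ℕ) = 2 * (z / 2 + n) := by push_cast; ring
    rw [e1, e2, one_div, one_div, mul_inv, mul_inv]
    ring
  have hodd := (hall.summable.comp_injective
    (i := fun n : ℕ => 2 * n + 1) fun a b h => by simpa using h).hasSum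
  have hsplit := hall.unique (HasSum.even_add_odd
    (f := fun n : ℕ => 1 / (z - n) + 1 / (z + n)) heven hodd)
  have hres := HasSum.even_add_odd
    (f := fun n : ℕ => (-1 : ℂ) ^ n * (1 / (z - n) + 1 / (z + n)))
    (heven.congr_fun fun n => by rw [pow_mul, neg_one_sq, one_pow, one_mul])
    (hodd.neg.congr_fun fun n => by
      rw [pow_succ, pow_mul, neg_one_sq, one_pow, one_mul, neg_one_mul]; rfl)
  convert hres using 1
  simp only [Function.comp_def] at *
  have hs : Complex.sin (Real.pi * z) ≠ 0 := sin_pi_mul_ne_zero hz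
  have hs2 : Complex.sin (Real.pi * (z / 2)) ≠ 0 := sin_pi_mul_ne_zero hz2
  have hz0 : z ≠ 0 := Complex.integerComplement.ne_zero hz
  have hsin : Complex.sin (Real.pi * z) =
      2 * Complex.sin (Real.pi * (z / 2)) * Complex.cos (Real.pi * (z / 2)) := by
    rw [← Complex.sin_two_mul]; ring_nf
  have hcos : Complex.cos (Real.pi * z) = 2 * Complex.cos (Real.pi * (z / 2)) ^ 2 - 1 := by
    rw [← Complex.cos_two_mul]; ring_nf
  have key : (Real.pi : ℂ) / Complex.sin (Real.pi * z) =
      Real.pi * Complex.cot (Real.pi * (z / 2)) - Real.pi * Complex.cot (Real.pi * z) := by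
    have hc2 : Complex.cos (Real.pi * (z / 2)) ≠ 0 := fun h => hs (by rw [hsin, h, mul_zero])
    rw [Complex.cot, Complex.cot, hcos, hsin]
    field_simp
    ring
  rw [key]
  have e : (1 : ℂ) / (z / 2) = 2 * (1 / z) := by field_simp
  rw [e] at hsplit ⊢
  linear_combination -hsplit

/-- Imaginary part of the cosecant series at z = 1/6 + ic, times -1/c. Here sin(πz) = cosh(πc)/2 +
i(√3/2) sinh(πc), whose squared modulus is (4cosh²(πc) - 3)/4. -/
theorem hasSum_alternating_one_div_sq_add_sq {c : ℝ} (hc : 0 < c) :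
    HasSum (fun n : ℕ => (-1 : ℝ) ^ n *
      (1 / ((n + 1 / 6) ^ 2 + c ^ 2) + 1 / ((n - 1 / 6) ^ 2 + c ^ 2)))
      (2 * √3 * Real.pi / c * (Real.sinh (Real.pi * c) / (4 * Real.cosh (Real.pi * c) ^ 2 - 3)) +
        1 / ((1 / 6) ^ 2 + c ^ 2)) := by
  let z : ℂ := ⟨1 / 6, c⟩
  have hmem {w : ℂ} (hw : w.im ≠ 0) : w ∈ Complex.integerComplement := by
    rintro ⟨n, rfl⟩
    simp at hw
  have hz2 : (z / 2).im ≠ 0 := by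
    have : (z / 2).im = c / 2 := by simp [z]
    rw [this]; positivity
  have h := (Complex.hasSum_im (hasSum_cosecant (hmem (w := z) hc.ne') (hmem hz2))).mul_left (-1 / c)
  have him (a : ℝ) : (1 / (⟨a, c⟩ : ℂ)).im = -c * (1 / (a ^ 2 + c ^ 2)) := by
    rw [one_div, Complex.inv_im, Complex.normSq_mk]
    ring
  have hval : 2 * √3 * Real.pi / c *
      (Real.sinh (Real.pi * c) / (4 * Real.cosh (Real.pi * c) ^ 2 - 3)) + 1 / ((1 / 6) ^ 2 + c ^ 2) =
      -1 / c * (Real.pi / Complex.sin (Real.pi * z) + 1 / z).im := by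
    rw [Complex.add_im, him]
    have hsin : Complex.sin (Real.pi * z) =
        ⟨1 / 2 * Real.cosh (Real.pi * c), √3 / 2 * Real.sinh (Real.pi * c)⟩ := by
      have : (Real.pi * z : ℂ) = ((Real.pi / 6 : ℝ) : ℂ) + ((Real.pi * c : ℝ) : ℂ) * Complex.I := by
        apply Complex.ext <;> simp [z]
        ring
      rw [this, Complex.sin_add_mul_I, ← Complex.ofReal_sin, ← Complex.ofReal_cos,
        ← Complex.ofReal_sinh, ← Complex.ofReal_cosh, Real.sin_pi_div_six, Real.cos_pi_div_six]
      generalize Real.cosh (Real.pi * c) = a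
      generalize Real.sinh (Real.pi * c) = b
      apply Complex.ext <;> simp
    have h3 : √3 ^ 2 = (3 : ℝ) := Real.sq_sqrt (by norm_num)
    have hcs := Real.cosh_sq (Real.pi * c)
    have hD : 4 * Real.cosh (Real.pi * c) ^ 2 - 3 ≠ 0 := by nlinarith [Real.one_le_cosh (Real.pi * c)]
    rw [hsin, div_eq_mul_inv (Real.pi : ℂ), Complex.im_ofReal_mul, Complex.inv_im, Complex.normSq_mk]
    have e : 1 / 2 * Real.cosh (Real.pi * c) * (1 / 2 * Real.cosh (Real.pi * c)) +
        √3 / 2 * Real.sinh (Real.pi * c) * (√3 / 2 * Real.sinh (Real.pi * c)) =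
        (4 * Real.cosh (Real.pi * c) ^ 2 - 3) / 4 := by
      have : Real.sinh (Real.pi * c) ^ 2 = Real.cosh (Real.pi * c) ^ 2 - 1 := by linarith
      ring_nf
      rw [h3, this]
      ring
    rw [e]
    field_simp
    ring
  rw [hval]
  refine h.congr_fun fun n => ?_
  have e1 : z - n = ⟨1 / 6 - n, c⟩ := by apply Complex.ext <;> simp [z]
  have e2 : z + n = ⟨1 / 6 + n, c⟩ := by apply Complex.ext <;> simp [z]
  have e3 : ((-1 : ℂ) ^ n) = (((-1 : ℝ) ^ n : ℝ) : ℂ) := by push_cast; rfl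
  rw [e3, Complex.im_ofReal_mul, Complex.add_im,
    e1, e2, him, him]
  field_simp
  ring_nf

/-- Closed form of the Laplace transform of the Euler function. -/
theorem eulerLaplace_eq {s c : ℝ} (hc : 0 < c) (hs : 24 * s - 1 = 36 * c ^ 2) :
    eulerLaplace s = 4 * Real.pi / (√3 * c) *
      (Real.sinh (Real.pi * c) / (4 * Real.cosh (Real.pi * c) ^ 2 - 3)) := by
  have hs0 : 0 < s := by nlinarith
  have h := hasSum_alternating_one_div_sq_add_sq hc
  have e1 (k : ℕ) : 1 / (s + pentagonal (-k)) = 2 / 3 * (1 / ((k + 1 / 6) ^ 2 + c ^ 2)) := by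
    have h1 : (2 * pentagonal (-k) : ℝ) = k * (3 * k + 1) := by
      exact_mod_cast two_mul_natCast_pentagonal_neg k
    have h2 : s + pentagonal (-k) = 3 / 2 * ((k + 1 / 6) ^ 2 + c ^ 2) := by
      linear_combination h1 / 2 + hs / 24
    rw [h2, one_div, mul_inv]
    ring
  have e2 (k : ℕ) : 1 / (s + pentagonal (k + 1)) =
      2 / 3 * (1 / (((k + 1 : ℕ) - 1 / 6) ^ 2 + c ^ 2)) := by
    have h1 : (2 * pentagonal (k + 1) : ℝ) = (k + 1) * (3 * (k + 1) - 1) := by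
      exact_mod_cast two_mul_natCast_pentagonal (k + 1)
    have h2 : s + pentagonal (k + 1) = 3 / 2 * (((k + 1 : ℕ) - 1 / 6) ^ 2 + c ^ 2) := by
      push_cast
      linear_combination h1 / 2 + hs / 24
    rw [h2, one_div, mul_inv]
    ring
  have hsgn {f : ℕ → ℝ} (hf : Summable f) (hf0 : ∀ k, 0 ≤ f k) :
      Summable fun k => (-1) ^ k * f k :=
    Summable.of_norm_bounded hf fun k => by simp [abs_of_nonneg (hf0 k)]
  have hA := (hsgn (summable_one_div_pentagonal_neg hs0) fun k => by positivity)
  have hB := (hsgn (summable_one_div_pentagonal_add_one hs0) fun k => by positivity)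
  have hL := hasSum_eulerLaplace hs0
  simp_rw [mul_sub] at hL
  have hL' := hL.unique (hA.hasSum.sub hB.hasSum)
  -- Shifting k + 1 to k flips the sign and adds an n = 0 term, which cancels the extra summand in
  -- `h`.
  have hB' : HasSum (fun k : ℕ => (-1 : ℝ) ^ k * (2 / 3 * (1 / ((k - 1 / 6 : ℝ) ^ 2 + c ^ 2))))
      (-(∑' k : ℕ, (-1 : ℝ) ^ k * (1 / (s + pentagonal (k + 1)))) +
        2 / 3 * (1 / ((1 / 6) ^ 2 + c ^ 2))) := by
    rw [← hasSum_nat_add_iff' 1]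
    rw [Finset.sum_range_one]
    have hv (u v : ℝ) : -u + 2 / 3 * (1 / ((1 / 6) ^ 2 + v)) -
        (-1) ^ 0 * (2 / 3 * (1 / (((0 : ℕ) - 1 / 6) ^ 2 + v))) = -u := by
      norm_num
    rw [hv]
    refine hB.hasSum.neg.congr_fun fun k => ?_
    rw [e2, pow_succ]
    ring
  have hA' := hA.hasSum
  simp_rw [e1] at hA'
  have htot := (h.mul_left (2 / 3)).unique ((hA'.add hB').congr_fun fun n => by ring)
  rw [hL']
  simp_rw [e1]
  have h3 : √3 ^ 2 = (3 : ℝ) := Real.sq_sqrt (by norm_num)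
  have h4 : 4 * Real.pi / (√3 * c) = 2 / 3 * (2 * √3 * Real.pi / c) := by
    field_simp
    rw [h3]
    ring
  rw [h4]
  linear_combination -htot

/-! ### Size of the transform for large argument -/

theorem pi_mul_sqrt_mul_sqrt_eq (s : ℝ) :
    Real.pi * √(2 / 3) * √s = Real.pi / 6 * √(24 * s) := by
  have : √(24 * s) = 6 * (√(2 / 3) * √s) := by
    rw [← Real.sqrt_mul (by norm_num)]
    have : 24 * s = 6 ^ 2 * (2 / 3 * s) := by ring
    rw [this, Real.sqrt_mul (by norm_num), Real.sqrt_sq (by norm_num)]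
  rw [this]
  ring

theorem sinh_div_four_mul_cosh_sq_sub_three_le (y : ℝ) :
    Real.sinh y / (4 * Real.cosh y ^ 2 - 3) ≤ 2 * Real.exp (-y) := by
  have h1 := Real.one_le_cosh y
  have h2 : Real.exp y * Real.exp (-y) = 1 := by rw [← Real.exp_add]; simp
  have h3 : Real.exp y / 2 ≤ Real.cosh y := by
    rw [Real.cosh_eq]; linarith [Real.exp_pos (-y)]
  have h4 : (Real.exp y / 2) ^ 2 ≤ 4 * Real.cosh y ^ 2 - 3 := by
    nlinarith [Real.exp_pos y]
  rw [div_le_iff₀ (by nlinarith), Real.sinh_eq]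
  have h5 := mul_le_mul_of_nonneg_left h4 (by positivity : 0 ≤ 2 * Real.exp (-y))
  have h6 : 2 * Real.exp (-y) * (Real.exp y / 2) ^ 2 = Real.exp y / 2 := by
    linear_combination Real.exp y / 2 * h2
  linarith [Real.exp_pos (-y)]

theorem eulerLaplace_eq_sqrt {s : ℝ} (hs : 1 ≤ s) :
    eulerLaplace s = 4 * Real.pi / (√3 * (√(24 * s - 1) / 6)) *
      (Real.sinh (Real.pi * (√(24 * s - 1) / 6)) /
        (4 * Real.cosh (Real.pi * (√(24 * s - 1) / 6)) ^ 2 - 3)) := by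
  have h : 0 < 24 * s - 1 := by linarith
  refine eulerLaplace_eq (by positivity) ?_
  rw [div_pow, Real.sq_sqrt h.le]
  ring

theorem eulerLaplace_le {s : ℝ} (hs : 1 ≤ s) :
    eulerLaplace s ≤
      16 * Real.pi * Real.exp 1 * Real.exp (-(Real.pi * √(2 / 3) * √s)) := by
  rw [eulerLaplace_eq_sqrt hs]
  set c := √(24 * s - 1) / 6 with hc
  have hsq : (6 * c) ^ 2 = 24 * s - 1 := by
    rw [hc, mul_div_cancel₀ _ (by norm_num), Real.sq_sqrt (by linarith)]
  have hc0 : 0 ≤ c := by positivity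
  have hc1 : 1 / 2 ≤ c := by nlinarith
  have h3 : 1 ≤ √3 := Real.one_le_sqrt.2 (by norm_num)
  have h1 : 4 * Real.pi / (√3 * c) ≤ 8 * Real.pi := by
    rw [div_le_iff₀ (by positivity)]
    have : 1 / 2 ≤ √3 * c := by nlinarith
    nlinarith [Real.pi_pos]
  -- The two exponents differ by at most π/6 < 1, which the factor e in the bound absorbs.
  have h2 : Real.pi * √(2 / 3) * √s ≤ 1 + Real.pi * c := by
    rw [pi_mul_sqrt_mul_sqrt_eq]
    have : √(24 * s) ≤ 6 * c + 1 := Real.sqrt_le_iff.2 ⟨by linarith, by nlinarith⟩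
    nlinarith [Real.pi_pos, Real.pi_lt_four]
  have h4 : Real.exp (-(Real.pi * c)) ≤
      Real.exp 1 * Real.exp (-(Real.pi * √(2 / 3) * √s)) := by
    rw [← Real.exp_add]
    exact Real.exp_le_exp.2 (by linarith)
  calc _ ≤ 4 * Real.pi / (√3 * c) * (2 * Real.exp (-(Real.pi * c))) :=
        mul_le_mul_of_nonneg_left (sinh_div_four_mul_cosh_sq_sub_three_le _) (by positivity)
    _ ≤ 8 * Real.pi * (2 * (Real.exp 1 * Real.exp (-(Real.pi * √(2 / 3) * √s)))) := by gcongr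
    _ = _ := by ring

/-- With u = e^{-2y} the function is (1 - u)/(2((1 + u)² - 3u)), and u → 0. -/
theorem tendsto_exp_mul_sinh_div :
    Tendsto (fun y : ℝ => Real.exp y * (Real.sinh y / (4 * Real.cosh y ^ 2 - 3))) atTop
      (nhds (1 / 2)) := by
  have hu : Tendsto (fun y : ℝ => Real.exp (-(2 * y))) atTop (nhds 0) :=
    Real.tendsto_exp_neg_atTop_nhds_zero.comp (tendsto_id.const_mul_atTop two_pos)
  have hlim := (hu.const_sub 1).div ((((hu.const_add 1).pow 2).sub (hu.const_mul 3)).const_mul 2)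
    (by norm_num)
  refine (hlim.congr fun y => ?_).trans_eq (by norm_num)
  have h2 : Real.exp y * Real.exp (-y) = 1 := by rw [← Real.exp_add]; simp
  have h3 : Real.exp (-(2 * y)) = Real.exp (-y) ^ 2 := by rw [← Real.exp_nat_mul]; ring_nf
  have h4 : 1 ≤ Real.cosh y := Real.one_le_cosh y
  have hD : 4 * Real.cosh y ^ 2 - 3 ≠ 0 := by nlinarith
  have h5 : (1 + Real.exp (-(2 * y))) ^ 2 - 3 * Real.exp (-(2 * y)) =
      Real.exp (-y) ^ 2 * (4 * Real.cosh y ^ 2 - 3) := by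
    rw [h3, Real.cosh_eq]
    linear_combination (-(1 + Real.exp y * Real.exp (-y)) - 2 * Real.exp (-y) ^ 2) * h2
  simp only [Pi.div_apply]
  rw [h5, ← mul_div_assoc, div_eq_div_iff (by positivity) hD, h3, Real.sinh_eq]
  linear_combination (4 * Real.cosh y ^ 2 - 3) * (-(Real.exp y * Real.exp (-y) + 1) +
    Real.exp (-y) ^ 2) * h2

/-- With c = √(24s - 1)/6, the quotient of the two sides is 4/(√3√2) · √s/c · e^{π√(2s/3) - πc} ·
e^{πc} sinh(πc)/(4cosh²(πc) - 3). The last three factors tend to √(3/2), 1 and 1/2. -/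
theorem isEquivalent_mul_eulerLaplace :
    (fun s : ℝ => s * eulerLaplace s) ~[atTop]
      fun s => Real.pi * √(2 * s) * Real.exp (-(Real.pi * √(2 / 3) * √s)) := by
  have hc : Tendsto (fun s : ℝ => √(24 * s - 1) / 6) atTop atTop :=
    (Real.tendsto_sqrt_atTop.comp (tendsto_atTop_add_const_right _ (-1)
      (tendsto_id.const_mul_atTop (by norm_num : (0 : ℝ) < 24)))).atTop_div_const (by norm_num)
  have hR := tendsto_exp_mul_sinh_div.comp (hc.const_mul_atTop Real.pi_pos)
  have hE : Tendsto (fun s : ℝ => Real.exp (Real.pi * √(2 / 3) * √s -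
      Real.pi * (√(24 * s - 1) / 6))) atTop (nhds 1) := by
    rw [show nhds (1 : ℝ) = nhds (Real.exp 0) by simp]
    refine (Real.continuous_exp.tendsto 0).comp ?_
    refine squeeze_zero' (g := fun s => Real.pi / 6 * (√s)⁻¹) ?_ ?_ ?_
    · filter_upwards [eventually_ge_atTop 1] with s hs
      rw [pi_mul_sqrt_mul_sqrt_eq]
      have : √(24 * s - 1) ≤ √(24 * s) := Real.sqrt_le_sqrt (by linarith)
      nlinarith [Real.pi_pos]
    · filter_upwards [eventually_ge_atTop 1] with s hs
      rw [pi_mul_sqrt_mul_sqrt_eq]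
      have h1 : √s ≤ √(24 * s) := Real.sqrt_le_sqrt (by linarith)
      have h2 : √(24 * s - 1) ≤ √(24 * s) := Real.sqrt_le_sqrt (by linarith)
      have h3 : √(24 * s) ^ 2 = 24 * s := Real.sq_sqrt (by linarith)
      have h4 : √(24 * s - 1) ^ 2 = 24 * s - 1 := Real.sq_sqrt (by linarith)
      have h5 : 0 < √s := Real.sqrt_pos.2 (by linarith)
      have h6 : √(24 * s) - √(24 * s - 1) ≤ (√s)⁻¹ := by
        rw [← one_div, le_div_iff₀ h5]
        nlinarith [Real.sqrt_nonneg (24 * s - 1)]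
      have h7 := mul_le_mul_of_nonneg_left h6 (by positivity : 0 ≤ Real.pi / 6)
      linarith
    · simpa using (tendsto_inv_atTop_zero.comp Real.tendsto_sqrt_atTop).const_mul (Real.pi / 6)
  have hd : Tendsto (fun s : ℝ => √s / (√(24 * s - 1) / 6)) atTop (nhds √(3 / 2)) := by
    have h : Tendsto (fun s : ℝ => 36 / (24 - s⁻¹)) atTop (nhds (36 / (24 - 0))) :=
      tendsto_const_nhds.div (tendsto_inv_atTop_zero.const_sub 24) (by norm_num)
    rw [show (36 : ℝ) / (24 - 0) = 3 / 2 by norm_num] at h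
    refine ((Real.continuous_sqrt.tendsto _).comp h).congr' ?_
    filter_upwards [eventually_ge_atTop 1] with s hs
    have h1 : 0 < 24 * s - 1 := by linarith
    have h2 : (36 : ℝ) / (24 - s⁻¹) = 6 ^ 2 * (s / (24 * s - 1)) := by
      have : (24 : ℝ) - s⁻¹ = (24 * s - 1) / s := by field_simp
      rw [this]
      field_simp
      norm_num
    rw [Function.comp, h2, Real.sqrt_mul (by norm_num), Real.sqrt_sq (by norm_num),
      Real.sqrt_div (by linarith)]
    field_simp
  refine (isEquivalent_iff_tendsto_one ?_).2 ?_
  · filter_upwards [eventually_ge_atTop 1] with s hs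
    positivity
  have hlim := ((hd.const_mul (4 / (√3 * √2))).mul hE).mul hR
  refine (hlim.congr' ?_).trans_eq ?_
  · filter_upwards [eventually_ge_atTop 1] with s hs
    simp only [Function.comp, Pi.div_apply]
    have hs0 : 0 < s := by linarith
    rw [eulerLaplace_eq_sqrt hs, Real.sqrt_mul (by norm_num) s, Real.exp_sub, Real.exp_neg]
    have hc0 : 0 < √(24 * s - 1) := Real.sqrt_pos.2 (by linarith)
    have h2 : √s ^ 2 = s := Real.sq_sqrt hs0.le
    generalize Real.sinh (Real.pi * (√(24 * s - 1) / 6)) /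
        (4 * Real.cosh (Real.pi * (√(24 * s - 1) / 6)) ^ 2 - 3) = r
    field_simp
    rw [h2]
  · congr 1
    have h3 : √(3 / 2) = √3 / √2 := Real.sqrt_div (by norm_num) 2
    have h2 : √2 ^ 2 = (2 : ℝ) := Real.sq_sqrt (by norm_num)
    rw [h3]
    field_simp
    rw [h2]
    norm_num

/-! ### Measurability and integrability -/

theorem aemeasurable_eulerFunction_exp_neg :
    AEMeasurable (fun t : ℝ => eulerFunction (Real.exp (-t))) (volume.restrict (Set.Ioi 0)) := by
  refine aemeasurable_of_tendsto_metrizable_ae (u := atTop)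
    (f := fun (n : ℕ) (t : ℝ) => ∏ i ∈ Finset.range n, (1 - Real.exp (-t) ^ (i + 1)))
    (fun n => by fun_prop) ?_
  refine (ae_restrict_iff' measurableSet_Ioi).2 (Eventually.of_forall fun t ht => ?_)
  have ht : (0 : ℝ) < t := ht
  exact (multipliable_one_sub_pow_add (Real.exp_pos (-t)).le
    (by rw [Real.exp_lt_one_iff]; linarith) 0).tendsto_prod_tprod_nat

theorem eulerFunction_exp_neg_mem_Icc {t : ℝ} (ht : 0 < t) :
    eulerFunction (Real.exp (-t)) ∈ Set.Icc (0 : ℝ) 1 :=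
  eulerFunction_mem_Icc (Real.exp_pos _).le (by rw [Real.exp_lt_one_iff]; linarith)

theorem integrableOn_exp_mul_eulerFunction {s : ℝ} (hs : 0 < s) :
    IntegrableOn (fun t : ℝ => Real.exp (-(s * t)) * eulerFunction (Real.exp (-t)))
      (Set.Ioi 0) := by
  refine (integrableOn_exp_neg_mul hs).mono'
    ((by fun_prop : Measurable fun t : ℝ => Real.exp (-(s * t))).aemeasurable.mul
      aemeasurable_eulerFunction_exp_neg).aestronglyMeasurable ?_
  refine (ae_restrict_iff' measurableSet_Ioi).2 (Eventually.of_forall fun t ht => ?_)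
  obtain ⟨h0, h1⟩ := eulerFunction_exp_neg_mem_Icc ht
  rw [Real.norm_of_nonneg (by positivity)]
  exact mul_le_of_le_one_right (by positivity) h1

theorem eulerLaplace_nonneg (s : ℝ) : 0 ≤ eulerLaplace s :=
  setIntegral_nonneg measurableSet_Ioi fun t ht => by
    have := (eulerFunction_exp_neg_mem_Icc ht).1
    positivity

/-! ### The probability as a series of transforms -/

/-- Resampling one coordinate of a product measure independently does not change its law. -/
theorem map_update_prod_infinitePi {ι : Type*} [DecidableEq ι] {E : ι → Type*}
    [∀ i, MeasurableSpace (E i)] (μ : ∀ i, Measure (E i)) [∀ i, IsProbabilityMeasure (μ i)]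
    (m : ι) :
    ((μ m).prod (Measure.infinitePi μ)).map (fun p => Function.update p.2 m p.1) =
      Measure.infinitePi μ := by
  have hmeas : Measurable fun p : E m × (∀ i, E i) => Function.update p.2 m p.1 := by
    refine measurable_pi_iff.2 fun i => ?_
    by_cases h : i = m
    · subst h
      simpa using measurable_fst
    · simp only [Function.update_of_ne h]
      fun_prop
  refine Measure.eq_infinitePi μ fun s t ht => ?_
  rw [Measure.map_apply hmeas (MeasurableSet.pi s.countable_toSet fun i _ => ht i)]
  by_cases hm : m ∈ s
  · have hpre : (fun p : E m × (∀ i, E i) => Function.update p.2 m p.1) ⁻¹' (Set.pi s t) =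
        t m ×ˢ Set.pi (s.erase m : Finset ι) t := by
      ext p
      simp only [Set.mem_preimage, Set.mem_pi, Set.mem_prod, Finset.mem_coe, Finset.mem_erase]
      constructor
      · intro h
        exact ⟨by simpa using h m hm, fun i hi => by simpa [hi.1] using h i hi.2⟩
      · rintro ⟨h1, h2⟩ i hi
        by_cases h : i = m
        · subst h; simpa using h1
        · simpa [h] using h2 i ⟨h, hi⟩
    rw [hpre, Measure.prod_prod, Measure.infinitePi_pi _ fun i _ => ht i,
      Finset.mul_prod_erase _ (fun i => μ i (t i)) hm]
  · have hpre : (fun p : E m × (∀ i, E i) => Function.update p.2 m p.1) ⁻¹' (Set.pi s t) =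
        Set.univ ×ˢ Set.pi s t := by
      ext p
      simp only [Set.mem_preimage, Set.mem_pi, Set.mem_prod, Finset.mem_coe, Set.mem_univ,
        true_and]
      refine forall₂_congr fun i hi => ?_
      rw [Function.update_of_ne (fun h : i = m => hm (h ▸ hi))]
    rw [hpre, Measure.prod_prod, Measure.infinitePi_pi _ fun i _ => ht i, measure_univ, one_mul]

/-- The probability that the coordinate `m` of a product measure is the largest one. -/
theorem infinitePi_forall_le {ι : Type*} [DecidableEq ι] [Countable ι] (μ : ι → Measure ℝ)
    [∀ i, IsProbabilityMeasure (μ i)] (m : ι) :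
    Measure.infinitePi μ {x | ∀ i, x i ≤ x m} =
      ∫⁻ t, ∏' i, (if i = m then 1 else μ i (Set.Iic t)) ∂μ m := by
  have hE : MeasurableSet {x : ι → ℝ | ∀ i, x i ≤ x m} := by
    simp_rw [Set.ofPred_forall]
    exact MeasurableSet.iInter fun i =>
      measurableSet_le (measurable_pi_apply i) (measurable_pi_apply m)
  have hmeas : Measurable fun p : ℝ × (ι → ℝ) => Function.update p.2 m p.1 := by
    refine measurable_pi_iff.2 fun i => ?_
    by_cases h : i = m
    · subst h
      simpa using measurable_fst
    · simp only [Function.update_of_ne h]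
      fun_prop
  -- Coordinate m is replaced by an independent copy t; for fixed t the event becomes a box,
  -- unconstrained at m.
  conv_lhs => rw [← map_update_prod_infinitePi μ m]
  rw [Measure.map_apply hmeas hE, Measure.prod_apply (hmeas hE)]
  refine lintegral_congr fun t => ?_
  have hset : Prod.mk t ⁻¹' ((fun p : ℝ × (ι → ℝ) => Function.update p.2 m p.1) ⁻¹'
      {x | ∀ i, x i ≤ x m}) =
      Set.univ.pi fun i => if i = m then Set.univ else Set.Iic t := by
    ext x
    simp only [Set.mem_preimage, Set.mem_ofPred_eq, Function.update_self, Set.mem_pi, Set.mem_univ,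
      true_implies]
    refine forall_congr' fun i => ?_
    by_cases h : i = m
    · subst h; simp
    · simp [h]
  rw [hset, Measure.infinitePi_pi_univ μ fun i => by split_ifs <;> measurability]
  refine tprod_congr fun i => ?_
  split_ifs <;> simp

theorem expMeasure_Iic {r t : ℝ} (hr : 0 < r) (ht : 0 ≤ t) :
    expMeasure r (Set.Iic t) = ENNReal.ofReal (1 - Real.exp (-(r * t))) := by
  have := isProbabilityMeasure_expMeasure hr
  rw [← ofReal_cdf, cdf_expMeasure_eq hr, if_pos ht]

theorem lintegral_expMeasure {r : ℝ} {f : ℝ → ENNReal} :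
    ∫⁻ t, f t ∂expMeasure r =
      ∫⁻ t in Set.Ioi 0, ENNReal.ofReal (r * Real.exp (-(r * t))) * f t := by
  rw [expMeasure, gammaMeasure]
  unfold gammaPDF
  rw [lintegral_withDensity_eq_lintegral_mul_non_measurable₀ _
    (measurable_gammaPDFReal 1 r).ennreal_ofReal.aemeasurable
    (Eventually.of_forall fun _ => ENNReal.ofReal_lt_top), ← lintegral_indicator measurableSet_Ioi]
  refine lintegral_congr_ae ?_
  filter_upwards [compl_mem_ae_iff.2 (Real.volume_singleton (a := 0))] with t ht
  rcases lt_or_gt_of_ne (show t ≠ 0 from ht) with h | h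
  · rw [Set.indicator_of_notMem (by simpa using h.le), Pi.mul_apply]
    have h0 : ENNReal.ofReal (gammaPDFReal 1 r t) = 0 := gammaPDF_of_neg h
    rw [h0, zero_mul]
  · rw [Set.indicator_of_mem (by simpa using h), Pi.mul_apply]
    congr 1
    exact exponentialPDF_of_nonneg h.le

/-- Factor m is divided out in ℝ; the product then passes through `ENNReal.ofReal`, continuous and
multiplicative on nonnegative factors. -/
theorem tprod_one_sub_exp_ite {t : ℝ} (ht : 0 < t) (m : ℕ+) :
    ∏' i : ℕ+, (if i = m then (1 : ENNReal) else ENNReal.ofReal (1 - Real.exp (-((i : ℕ) * t)))) =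
      ENNReal.ofReal (eulerFunction (Real.exp (-t)) / (1 - Real.exp (-((m : ℕ) * t)))) := by
  have hx : Real.exp (-t) < 1 := by rw [Real.exp_lt_one_iff]; linarith
  have hlt (i : ℕ+) : Real.exp (-((i : ℕ) * t)) < 1 := by
    rw [Real.exp_lt_one_iff, neg_lt_zero]
    have : (0 : ℝ) < (i : ℕ) := by exact_mod_cast i.pos
    positivity
  have h1 : HasProd (fun i : ℕ+ => 1 - Real.exp (-((i : ℕ) * t)))
      (eulerFunction (Real.exp (-t))) := by
    have h := (multipliable_one_sub_pow_add (Real.exp_pos (-t)).le hx 0).hasProd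
    rw [← Equiv.pnatEquivNat.hasProd_iff] at h
    refine HasProd.congr_fun h fun i => ?_
    simp only [Function.comp, Equiv.pnatEquivNat_apply, add_zero, PNat.natPred_add_one]
    rw [← Real.exp_nat_mul]
    ring_nf
  have h2 := h1.mul (hasProd_ite_eq m (1 - Real.exp (-((m : ℕ) * t)))⁻¹)
  have h3 : HasProd (fun i : ℕ+ => if i = m then (1 : ℝ) else 1 - Real.exp (-((i : ℕ) * t)))
      (eulerFunction (Real.exp (-t)) / (1 - Real.exp (-((m : ℕ) * t)))) := by
    rw [div_eq_mul_inv]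
    refine h2.congr_fun fun i => ?_
    split_ifs with h
    · subst h
      rw [mul_inv_cancel₀ (by linarith [hlt i])]
    · rw [mul_one]
  refine HasProd.tprod_eq ?_
  refine ((ENNReal.continuous_ofReal.tendsto _).comp h3).congr fun s => ?_
  rw [Function.comp, ENNReal.ofReal_prod_of_nonneg fun i _ => by
    split_ifs <;> linarith [hlt i]]
  refine Finset.prod_congr rfl fun i _ => ?_
  dsimp only
  split_ifs with h
  · exact ENNReal.ofReal_one
  · rfl

/-- Expands 1/(1 - e^{-mt}) geometrically; working in `ENNReal` makes the exchange of sum and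
integral free. -/
theorem infinitePi_expMeasure_forall_le (m : ℕ+) :
    Measure.infinitePi (fun i : ℕ+ => expMeasure ((i : ℕ) : ℝ)) {x | ∀ i, x i ≤ x m} =
      ∑' k : ℕ, ENNReal.ofReal ((m : ℕ) * eulerLaplace ((k + 1) * (m : ℕ))) := by
  have hpos (i : ℕ+) : (0 : ℝ) < (i : ℕ) := by exact_mod_cast i.pos
  have (i : ℕ+) := isProbabilityMeasure_expMeasure (hpos i)
  have hint (k : ℕ) := (integrableOn_exp_mul_eulerFunction (s := (k + 1) * (m : ℕ))
    (by have := hpos m; positivity)).const_mul (m : ℕ)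
  rw [infinitePi_forall_le, lintegral_expMeasure]
  have hterm (k : ℕ) : ENNReal.ofReal ((m : ℕ) * eulerLaplace ((k + 1) * (m : ℕ))) =
      ∫⁻ t in Set.Ioi (0 : ℝ), ENNReal.ofReal ((m : ℕ) * (Real.exp (-((k + 1) * (m : ℕ) * t)) *
        eulerFunction (Real.exp (-t)))) := by
    rw [eulerLaplace, ← integral_const_mul, ofReal_integral_eq_lintegral_ofReal (hint k)]
    refine (ae_restrict_iff' measurableSet_Ioi).2 (Eventually.of_forall fun t ht => ?_)
    have := (eulerFunction_exp_neg_mem_Icc ht).1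
    simp only [Pi.zero_apply]
    positivity
  simp_rw [hterm]
  rw [← lintegral_tsum fun k => (hint k).aestronglyMeasurable.aemeasurable.ennreal_ofReal]
  refine setLIntegral_congr_fun measurableSet_Ioi fun t ht => ?_
  have ht : (0 : ℝ) < t := ht
  have hφ := (eulerFunction_exp_neg_mem_Icc ht).1
  have hq : Real.exp (-((m : ℕ) * t)) < 1 := by
    rw [Real.exp_lt_one_iff, neg_lt_zero]
    have := hpos m
    positivity
  have hcongr : ∏' i : ℕ+, (if i = m then 1 else expMeasure ((i : ℕ) : ℝ) (Set.Iic t)) =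
      ENNReal.ofReal (eulerFunction (Real.exp (-t)) / (1 - Real.exp (-((m : ℕ) * t)))) := by
    rw [← tprod_one_sub_exp_ite ht m]
    simp_rw [expMeasure_Iic (hpos _) ht.le]
  rw [hcongr, ← ENNReal.ofReal_mul (by positivity)]
  have hgeo := ((hasSum_geometric_of_lt_one (Real.exp_pos _).le hq).mul_left
    ((m : ℕ) * Real.exp (-((m : ℕ) * t)) * eulerFunction (Real.exp (-t))))
  have hgeo' : HasSum (fun k : ℕ => (m : ℕ) * (Real.exp (-((k + 1) * (m : ℕ) * t)) *
      eulerFunction (Real.exp (-t)))) ((m : ℕ) * Real.exp (-((m : ℕ) * t)) *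
        (eulerFunction (Real.exp (-t)) / (1 - Real.exp (-((m : ℕ) * t))))) := by
    rw [div_eq_mul_inv, ← mul_assoc]
    refine hgeo.congr_fun fun k => ?_
    have : -((k + 1) * (m : ℕ) * t) = -((m : ℕ) * t) + k * -((m : ℕ) * t) := by ring
    rw [← Real.exp_nat_mul, this, Real.exp_add]
    ring
  rw [← hgeo'.tsum_eq, ENNReal.ofReal_tsum_of_nonneg (fun k => by positivity) hgeo'.summable]

theorem hasSum_measureReal_eq_iSup {Ω : Type*} [MeasurableSpace Ω] (P : Measure Ω)
    [IsProbabilityMeasure P] (X : ℕ+ → Ω → ℝ)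
    (hX : ∀ i : ℕ+, HasLaw (X i) (expMeasure ((i : ℕ) : ℝ)) P) (hindep : iIndepFun X P) (m : ℕ+) :
    HasSum (fun k : ℕ => (m : ℕ) * eulerLaplace ((k + 1) * (m : ℕ)))
      (P.real {ω | (X m ω : EReal) = ⨆ i : ℕ+, (X i ω : EReal)}) := by
  have (i : ℕ+) := isProbabilityMeasure_expMeasure (show (0 : ℝ) < (i : ℕ) by exact_mod_cast i.pos)
  have hlaw := hindep.hasLaw_infinitePi hX (aemeasurable_pi_iff.2 fun i => (hX i).aemeasurable)
  have hE : MeasurableSet {x : ℕ+ → ℝ | ∀ i, x i ≤ x m} := by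
    simp_rw [Set.ofPred_forall]
    exact MeasurableSet.iInter fun i =>
      measurableSet_le (measurable_pi_apply i) (measurable_pi_apply m)
  have hset : {ω | (X m ω : EReal) = ⨆ i : ℕ+, (X i ω : EReal)} = {ω | ∀ i, X i ω ≤ X m ω} := by
    ext ω
    simp only [Set.mem_ofPred_eq]
    constructor
    · intro h i
      exact EReal.coe_le_coe_iff.1 (h ▸ le_iSup (fun i => (X i ω : EReal)) i)
    · exact fun h => le_antisymm (le_iSup (fun i => (X i ω : EReal)) m)
        (iSup_le fun i => EReal.coe_le_coe_iff.2 (h i))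
  have hP := (hlaw.measure_eq hE).trans (infinitePi_expMeasure_forall_le m)
  -- Summability in ℝ comes from the sum being a probability, hence finite.
  have hne : ∑' k : ℕ, ENNReal.ofReal ((m : ℕ) * eulerLaplace ((k + 1) * (m : ℕ))) ≠ ⊤ :=
    hP ▸ measure_ne_top _ _
  have hsum := ENNReal.hasSum_toReal hne
  rw [hset, Measure.real]
  have hP' : P {ω | ∀ i, X i ω ≤ X m ω} = _ := hP
  rw [hP', ENNReal.tsum_toReal_eq fun k => ENNReal.ofReal_ne_top]
  refine hsum.congr_fun fun k => ?_
  rw [ENNReal.toReal_ofReal (mul_nonneg (by positivity) (eulerLaplace_nonneg _))]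

/-! ### Negligibility of the terms after the first -/

/-- As s = (k + 2)m ≥ 2m, √m ≤ (3/4)√s. The spare quarter of the exponent, at least √s/2, is traded
for s⁻², summable in k. The constant is 384 = 2⁴ · 4!, from the fourth term of the exponential
series. -/
theorem exp_neg_mul_sqrt_add_two_mul_le {m : ℝ} (hm : 0 < m) (k : ℕ) :
    Real.exp (-(Real.pi * √(2 / 3) * √((k + 2) * m))) ≤
      Real.exp (-(Real.pi * √(2 / 3) * √m)) * (384 / ((k + 2) * m) ^ 2) := by
  set s : ℝ := (k + 2) * m with hs
  have hs0 : 0 < s := by positivity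
  have hk : (0 : ℝ) ≤ k := k.cast_nonneg
  have h1 : √m ≤ 3 / 4 * √s := by
    refine Real.sqrt_le_iff.2 ⟨by positivity, ?_⟩
    rw [mul_pow, Real.sq_sqrt hs0.le]
    nlinarith
  have ha : 2 ≤ Real.pi * √(2 / 3) := by
    have : 2 / 3 ≤ √(2 / 3 : ℝ) := Real.le_sqrt_of_sq_le (by norm_num)
    nlinarith [Real.pi_gt_three]
  have h2 : s ^ 2 / 384 ≤ Real.exp (√s / 2) := by
    have h := Real.pow_div_factorial_le_exp (x := √s / 2) (by positivity) 4
    have h4 : √s ^ 4 = s ^ 2 := by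
      rw [show √s ^ 4 = (√s ^ 2) ^ 2 by ring, Real.sq_sqrt hs0.le]
    have h5 : (√s / 2) ^ 4 / (Nat.factorial 4 : ℝ) = s ^ 2 / 384 := by
      rw [div_pow, h4]
      norm_num [Nat.factorial]
      ring
    rwa [h5] at h
  have h3 : 384 / s ^ 2 ≥ Real.exp (-(√s / 2)) := by
    rw [Real.exp_neg, ← inv_div]
    exact inv_anti₀ (by positivity) h2
  calc Real.exp (-(Real.pi * √(2 / 3) * √s))
      ≤ Real.exp (-(Real.pi * √(2 / 3) * √m) + -(√s / 2)) := by
        refine Real.exp_le_exp.2 ?_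
        nlinarith [Real.sqrt_nonneg s]
    _ = Real.exp (-(Real.pi * √(2 / 3) * √m)) * Real.exp (-(√s / 2)) := Real.exp_add _ _
    _ ≤ _ := by gcongr

theorem exists_tsum_eulerLaplace_le : ∃ C : ℝ, ∀ m : ℝ, 1 ≤ m →
    ‖∑' k : ℕ, m * eulerLaplace ((k + 2) * m)‖ ≤
      C * Real.exp (-(Real.pi * √(2 / 3) * √m)) * m⁻¹ := by
  have hsum : Summable fun k : ℕ => 1 / ((k : ℝ) + 2) ^ 2 := by
    have h := (summable_nat_add_iff 2).2 (Real.summable_one_div_nat_pow (p := 2) |>.2 (by norm_num))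
    simpa using h
  let B : ℝ := 16 * Real.pi * Real.exp 1 * 384
  refine ⟨B * ∑' k : ℕ, 1 / ((k : ℝ) + 2) ^ 2, fun m hm => ?_⟩
  have hm0 : 0 < m := by linarith
  have hbound := hsum.hasSum.mul_left (B * Real.exp (-(Real.pi * √(2 / 3) * √m)) * m⁻¹)
  refine (tsum_of_norm_bounded hbound fun k => ?_).trans_eq (by ring)
  rw [Real.norm_of_nonneg (mul_nonneg hm0.le (eulerLaplace_nonneg _))]
  have hk : (0 : ℝ) ≤ k := k.cast_nonneg
  calc m * eulerLaplace ((k + 2) * m)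
      ≤ m * (16 * Real.pi * Real.exp 1 * (Real.exp (-(Real.pi * √(2 / 3) * √m)) *
          (384 / ((k + 2) * m) ^ 2))) := by
        refine mul_le_mul_of_nonneg_left ((eulerLaplace_le (by nlinarith)).trans ?_) hm0.le
        exact mul_le_mul_of_nonneg_left (exp_neg_mul_sqrt_add_two_mul_le hm0 k) (by positivity)
    _ = _ := by
        simp only [B]
        field_simp

theorem isLittleO_tsum_eulerLaplace :
    (fun m : ℝ => ∑' k : ℕ, m * eulerLaplace ((k + 2) * m)) =o[atTop]
      fun m => Real.pi * √(2 * m) * Real.exp (-(Real.pi * √(2 / 3) * √m)) := by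
  obtain ⟨C, hC⟩ := exists_tsum_eulerLaplace_le
  have h1 : (fun m : ℝ => ∑' k : ℕ, m * eulerLaplace ((k + 2) * m)) =O[atTop]
      fun m => m⁻¹ * Real.exp (-(Real.pi * √(2 / 3) * √m)) := by
    refine IsBigO.of_bound C ?_
    filter_upwards [eventually_ge_atTop 1] with m hm
    have h0 : 0 ≤ m⁻¹ * Real.exp (-(Real.pi * √(2 / 3) * √m)) := by positivity
    rw [Real.norm_of_nonneg h0]
    exact (hC m hm).trans_eq (by ring)
  refine h1.trans_isLittleO (IsLittleO.mul_isBigO ?_ (isBigO_refl _ _))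
  have h2 : (fun m : ℝ => m⁻¹) =o[atTop] fun _ => (1 : ℝ) :=
    (isLittleO_one_iff ℝ).2 tendsto_inv_atTop_zero
  refine h2.trans_isBigO (IsBigO.of_bound 1 ?_)
  filter_upwards [eventually_ge_atTop 1] with m hm
  have h3 : 1 ≤ √(2 * m) := Real.one_le_sqrt.2 (by linarith)
  rw [norm_one, one_mul, Real.norm_of_nonneg (by positivity)]
  nlinarith [Real.pi_gt_three]

theorem mainTheorem1 {Ω : Type*} [MeasurableSpace Ω] (P : Measure Ω) [IsProbabilityMeasure P]
    (X : ℕ+ → Ω → ℝ)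
    (hX : ∀ i : ℕ+, HasLaw (X i) (expMeasure ((i : ℕ) : ℝ)) P)
    (hindep : iIndepFun X P)
    (M : Ω → EReal)
    (hM : ∀ ω, M ω = ⨆ i : ℕ+, (X i ω : EReal)) :
    (fun m : ℕ+ => P.real {ω | (X m ω : EReal) = M ω}) ~[atTop]
      (fun m : ℕ+ => Real.pi * √(2 * ((m : ℕ) : ℝ)) *
        Real.exp (-(Real.pi * √(2 / 3) * √((m : ℕ) : ℝ)))) := by
  have hcast : Tendsto (fun m : ℕ+ => ((m : ℕ) : ℝ)) atTop atTop :=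
    tendsto_natCast_atTop_atTop.comp tendsto_PNat_val_atTop_atTop
  have hmain := (isEquivalent_mul_eulerLaplace.add_isLittleO
    isLittleO_tsum_eulerLaplace).comp_tendsto hcast
  refine hmain.congr_left (Eventually.of_forall fun m => ?_)
  have h := hasSum_measureReal_eq_iSup P X hX hindep m
  simp_rw [hM]
  -- The term k = 0 is m L(m), the main term; the rest is the negligible tail.
  rw [← h.tsum_eq, h.summable.tsum_eq_zero_add]
  simp only [Function.comp, Pi.add_apply]
  congr 1
  · simp
  · refine tsum_congr fun k => ?_
    push_cast
    ring_nf
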